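/- Let $L^2=L^2(0,1)$. Let $H^1$ be the space of absolutely continuous functions $x:[0,1]\to\mathbb R$ whose weak derivative $\dot x$ belongs to $L^2$, let $H^2$ be the space of those $x\in H^1$ with $\dot x\in H^1$, and let $H^1_0=\{x\in H^1: x(0)=x(1)=0\}$. Let $\mathbb X=H^2\cap H^1_0$, normed by $\|x\|_{\mathbb X}=\|\ddot x\|_{L^2}$. Suppose that $f:[0,1]\times\mathbb R\to\mathbb R$ satisfies the following conditions. - $f$ is continuous on $[0,1]\times\mathbb R$, and it has a partial derivative $f_x$ with respect to the second variable that is continuous on $[0,1]\times\mathbb R$. - There are positive constants $A$ and $B$ with $A<\pi^2$ such that $|f(t,x)|\le A|x|+B$ for all $t\in[0,1]$ and $x\in\mathbb R$. - $\inf_{[0,1]\times\mathbb R} f_x>-\pi^2$. Then the operator $T:\mathbb X\to L^2$ given by $(Tx)(t)=\ddot x(t)-f(t,x(t))$ for almost every $t\in[0,1]$ is a diffeomorphism: it is a bijection of $\mathbb X$ onto $L^2$, it is of class $C^1$ (in the Fréchet sense), and its inverse $T^{-1}:L^2\to\mathbb X$ is of class $C^1$. -/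

import Mathlib

open Set MeasureTheory Filter
open scoped ContDiff unitInterval

namespace DirichletBVP

/-- The Hilbert space `L²(0,1)`. -/
abbrev L2 : Type := Lp ℝ 2 (volume.restrict (Ioo (0 : ℝ) 1))

/-- `g` is the weak derivative of `u` on `(0,1)`. It is only applied to functions `u`, `g` that are
integrable on `(0,1)`. -/
def HasWeakDeriv (u g : ℝ → ℝ) : Prop :=
  ∀ φ : ℝ → ℝ, ContDiff ℝ ∞ φ → HasCompactSupport φ → tsupport φ ⊆ Ioo 0 1 →
    ∫ t in Ioo (0 : ℝ) 1, u t * deriv φ t = -∫ t in Ioo (0 : ℝ) 1, g t * φ t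

/-- A function on `[0,1]`, extended to the real line by its values at the endpoints. Only the values
on `[0,1]` matter below. -/
noncomputable def extend (x : I → ℝ) : ℝ → ℝ := IccExtend zero_le_one x

/-- `x ∈ H¹`: absolutely continuous on `[0,1]` with a weak derivative in `L²(0,1)`. -/
def MemH1 (x : I → ℝ) : Prop :=
  AbsolutelyContinuousOnInterval (extend x) 0 1 ∧ ∃ g : L2, HasWeakDeriv (extend x) g

/-- `x ∈ H²`: `x ∈ H¹` and its weak derivative is (represented by) a function in `H¹`. -/
def MemH2 (x : I → ℝ) : Prop :=
  MemH1 x ∧ ∃ y : I → ℝ, MemH1 y ∧ HasWeakDeriv (extend x) (extend y)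

/-- `x ∈ H¹₀`. -/
def MemH10 (x : I → ℝ) : Prop := MemH1 x ∧ x 0 = 0 ∧ x 1 = 0

/-- `g` is the second weak derivative of `x`: the weak derivative of the `H¹` function `y` that is
the weak derivative of `x`. -/
def HasSecondDeriv (x : I → ℝ) (g : L2) : Prop :=
  ∃ y : I → ℝ, MemH1 y ∧ HasWeakDeriv (extend x) (extend y) ∧ HasWeakDeriv (extend y) g

theorem extend_coe (x : I → ℝ) (t : I) : extend x t = x t := IccExtend_val _ _ _

theorem extend_add (x y : I → ℝ) : extend (x + y) = extend x + extend y := rfl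

theorem extend_smul (c : ℝ) (x : I → ℝ) : extend (c • x) = c • extend x := rfl

theorem integrableOn_L2 (g : L2) : IntegrableOn g (Ioo 0 1) :=
  (Lp.memLp g).integrable (by norm_num)

theorem continuousOn_of_ac {u : ℝ → ℝ} (hu : AbsolutelyContinuousOnInterval u 0 1) :
    ContinuousOn u (Icc 0 1) := by
  simpa [uIcc_of_le zero_le_one] using hu.continuousOn

theorem integrableOn_of_ac {u : ℝ → ℝ} (hu : AbsolutelyContinuousOnInterval u 0 1) :
    IntegrableOn u (Ioo 0 1) :=
  ((continuousOn_of_ac hu).integrableOn_compact isCompact_Icc).mono_set Ioo_subset_Icc_self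

theorem integrable_mul {u ψ : ℝ → ℝ} (hu : IntegrableOn u (Ioo 0 1)) (hψ : Continuous ψ)
    (hc : HasCompactSupport ψ) : IntegrableOn (fun t => u t * ψ t) (Ioo 0 1) := by
  obtain ⟨C, hC⟩ := hψ.bounded_above_of_compact_support hc
  exact Integrable.mul_bdd (c := C) hu hψ.aestronglyMeasurable (Eventually.of_forall hC)

theorem integrable_mul_deriv {u φ : ℝ → ℝ} (hu : IntegrableOn u (Ioo 0 1)) (hφ : ContDiff ℝ ∞ φ)
    (hc : HasCompactSupport φ) : IntegrableOn (fun t => u t * deriv φ t) (Ioo 0 1) :=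
  integrable_mul hu (hφ.continuous_deriv (by simp)) hc.deriv

theorem HasWeakDeriv.add {u v g h : ℝ → ℝ} (hug : HasWeakDeriv u g) (hvh : HasWeakDeriv v h)
    (hu : IntegrableOn u (Ioo 0 1)) (hv : IntegrableOn v (Ioo 0 1))
    (hg : IntegrableOn g (Ioo 0 1)) (hh : IntegrableOn h (Ioo 0 1)) :
    HasWeakDeriv (u + v) (g + h) := by
  intro φ h1 h2 h3
  simp only [Pi.add_apply, add_mul]
  rw [integral_add (integrable_mul_deriv hu h1 h2) (integrable_mul_deriv hv h1 h2),
    integral_add (integrable_mul hg h1.continuous h2) (integrable_mul hh h1.continuous h2),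
    hug φ h1 h2 h3, hvh φ h1 h2 h3]
  ring

theorem HasWeakDeriv.smul {u g : ℝ → ℝ} (c : ℝ) (hug : HasWeakDeriv u g) :
    HasWeakDeriv (c • u) (c • g) := by
  intro φ h1 h2 h3
  simp only [Pi.smul_apply, smul_eq_mul, mul_assoc]
  rw [integral_const_mul, integral_const_mul, hug φ h1 h2 h3]
  ring

theorem HasWeakDeriv.congr {u v g h : ℝ → ℝ} (hug : HasWeakDeriv u g)
    (huv : u =ᵐ[volume.restrict (Ioo 0 1)] v) (hgh : g =ᵐ[volume.restrict (Ioo 0 1)] h) :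
    HasWeakDeriv v h := by
  intro φ h1 h2 h3
  have e1 : ∫ t in Ioo (0 : ℝ) 1, v t * deriv φ t = ∫ t in Ioo (0 : ℝ) 1, u t * deriv φ t :=
    integral_congr_ae (by filter_upwards [huv] with t ht; rw [ht])
  have e2 : ∫ t in Ioo (0 : ℝ) 1, h t * φ t = ∫ t in Ioo (0 : ℝ) 1, g t * φ t :=
    integral_congr_ae (by filter_upwards [hgh] with t ht; rw [ht])
  rw [e1, e2, hug φ h1 h2 h3]

theorem HasWeakDeriv.unique {u g h : ℝ → ℝ} (hug : HasWeakDeriv u g) (huh : HasWeakDeriv u h)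
    (hg : IntegrableOn g (Ioo 0 1)) (hh : IntegrableOn h (Ioo 0 1)) :
    g =ᵐ[volume.restrict (Ioo 0 1)] h := by
  have key : ∀ᵐ t ∂(volume : Measure ℝ), t ∈ Ioo (0 : ℝ) 1 → (g - h) t = 0 := by
    refine isOpen_Ioo.ae_eq_zero_of_integral_contDiff_smul_eq_zero
      (hg.sub hh).locallyIntegrableOn ?_
    intro φ h1 h2 h3
    have e : ∫ t, φ t • (g - h) t = ∫ t in Ioo (0 : ℝ) 1, φ t • (g - h) t := by
      rw [setIntegral_eq_integral_of_forall_compl_eq_zero]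
      intro t ht
      rw [image_eq_zero_of_notMem_tsupport (fun h' => ht (h3 h')), zero_smul]
    rw [e]
    have e2 : ∫ t in Ioo (0 : ℝ) 1, φ t • (g - h) t
        = (∫ t in Ioo (0 : ℝ) 1, g t * φ t) - ∫ t in Ioo (0 : ℝ) 1, h t * φ t := by
      rw [← integral_sub (integrable_mul hg h1.continuous h2)
        (integrable_mul hh h1.continuous h2)]
      refine integral_congr_ae (Eventually.of_forall fun t => ?_)
      simp only [Pi.sub_apply, smul_eq_mul]
      ring
    have := hug φ h1 h2 h3
    have := huh φ h1 h2 h3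
    rw [e2]
    linarith
  refine (ae_restrict_iff' measurableSet_Ioo).2 ?_
  filter_upwards [key] with t ht h'
  have := ht h'
  simpa [sub_eq_zero] using this

/-- The almost everywhere derivative of an absolutely continuous function is its weak derivative. -/
theorem hasWeakDeriv_deriv {u : ℝ → ℝ} (hu : AbsolutelyContinuousOnInterval u 0 1) :
    HasWeakDeriv u (deriv u) := by
  intro φ h1 h2 h3
  have hφ : AbsolutelyContinuousOnInterval φ 0 1 :=
    (h1.of_le (by simp)).contDiffOn.absolutelyContinuousOnInterval
  have h := hu.integral_mul_deriv_eq_deriv_mul hφ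
  have h0 : φ 0 = 0 := image_eq_zero_of_notMem_tsupport fun h' => by simpa using h3 h'
  have h1' : φ 1 = 0 := image_eq_zero_of_notMem_tsupport fun h' => by simpa using h3 h'
  rw [h0, h1', intervalIntegral.integral_of_le zero_le_one,
    intervalIntegral.integral_of_le zero_le_one, integral_Ioc_eq_integral_Ioo,
    integral_Ioc_eq_integral_Ioo] at h
  rw [h]
  ring

theorem integrableOn_deriv {u : ℝ → ℝ} (hu : AbsolutelyContinuousOnInterval u 0 1) :
    IntegrableOn (deriv u) (Ioo 0 1) := by
  have := hu.intervalIntegrable_deriv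
  rw [intervalIntegrable_iff_integrableOn_Ioo_of_le zero_le_one] at this
  exact this

/-- An absolutely continuous function is recovered from its weak derivative by integration. -/
theorem HasWeakDeriv.integral_eq {u g : ℝ → ℝ} (hu : AbsolutelyContinuousOnInterval u 0 1)
    (hug : HasWeakDeriv u g) (hg : IntegrableOn g (Ioo 0 1)) {t : ℝ} (ht : t ∈ Icc (0 : ℝ) 1) :
    ∫ s in (0 : ℝ)..t, g s = u t - u 0 := by
  have hut : AbsolutelyContinuousOnInterval u 0 t :=
    hu.mono (by rw [uIcc_of_le ht.1, uIcc_of_le zero_le_one]; exact Icc_subset_Icc_right ht.2)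
  rw [← hut.integral_deriv_eq_sub, intervalIntegral.integral_of_le ht.1,
    intervalIntegral.integral_of_le ht.1, integral_Ioc_eq_integral_Ioo,
    integral_Ioc_eq_integral_Ioo]
  exact integral_congr_ae (ae_restrict_of_ae_restrict_of_subset (Ioo_subset_Ioo_right ht.2)
    (hug.unique (hasWeakDeriv_deriv hu) hg (integrableOn_deriv hu)))

theorem MemH1.add {x y : I → ℝ} (hx : MemH1 x) (hy : MemH1 y) : MemH1 (x + y) := by
  obtain ⟨hx, g, hg⟩ := hx
  obtain ⟨hy, h, hh⟩ := hy
  refine ⟨hx.add hy, g + h, ?_⟩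
  exact (hg.add hh (integrableOn_of_ac hx) (integrableOn_of_ac hy) (integrableOn_L2 g)
    (integrableOn_L2 h)).congr EventuallyEq.rfl (Lp.coeFn_add g h).symm

theorem MemH1.smul {x : I → ℝ} (c : ℝ) (hx : MemH1 x) : MemH1 (c • x) := by
  obtain ⟨hx, g, hg⟩ := hx
  exact ⟨hx.const_smul c, c • g, (hg.smul c).congr EventuallyEq.rfl (Lp.coeFn_smul c g).symm⟩

theorem MemH1.zero : MemH1 0 := by
  refine ⟨?_, 0, ?_⟩
  · have : LipschitzOnWith 0 (extend 0) (uIcc 0 1) := (LipschitzWith.const (0 : ℝ)).lipschitzOnWith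
    exact this.absolutelyContinuousOnInterval
  · have : HasWeakDeriv (extend 0) 0 := fun φ _ _ _ => by simp [extend, IccExtend]
    exact this.congr EventuallyEq.rfl (Lp.coeFn_zero ℝ 2 _).symm

theorem MemH2.add {x y : I → ℝ} (hx : MemH2 x) (hy : MemH2 y) : MemH2 (x + y) := by
  obtain ⟨hx, g, hg, hxg⟩ := hx
  obtain ⟨hy, h, hh, hyh⟩ := hy
  exact ⟨hx.add hy, g + h, hg.add hh, hxg.add hyh (integrableOn_of_ac hx.1)
    (integrableOn_of_ac hy.1) (integrableOn_of_ac hg.1) (integrableOn_of_ac hh.1)⟩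

theorem MemH2.smul {x : I → ℝ} (c : ℝ) (hx : MemH2 x) : MemH2 (c • x) := by
  obtain ⟨hx, g, hg, hxg⟩ := hx
  exact ⟨hx.smul c, c • g, hg.smul c, hxg.smul c⟩

theorem MemH2.zero : MemH2 0 :=
  ⟨MemH1.zero, 0, MemH1.zero, fun φ _ _ _ => by simp [extend, IccExtend]⟩

theorem MemH2.exists_hasSecondDeriv {x : I → ℝ} (hx : MemH2 x) : ∃ g, HasSecondDeriv x g := by
  obtain ⟨_, y, ⟨hy, g, hg⟩, hxy⟩ := hx
  exact ⟨g, y, ⟨hy, g, hg⟩, hxy, hg⟩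

theorem HasSecondDeriv.unique {x : I → ℝ} {g h : L2} (hg : HasSecondDeriv x g)
    (hh : HasSecondDeriv x h) : g = h := by
  obtain ⟨y, hy, hxy, hyg⟩ := hg
  obtain ⟨z, hz, hxz, hzh⟩ := hh
  have hyz := hxy.unique hxz (integrableOn_of_ac hy.1) (integrableOn_of_ac hz.1)
  exact Lp.ext (hyg.unique (hzh.congr hyz.symm EventuallyEq.rfl) (integrableOn_L2 g)
    (integrableOn_L2 h))

theorem HasSecondDeriv.add {x y : I → ℝ} {g h : L2} (hg : HasSecondDeriv x g)
    (hh : HasSecondDeriv y h) (hx : MemH1 x) (hy : MemH1 y) : HasSecondDeriv (x + y) (g + h) := by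
  obtain ⟨x', hx', hxx', hx'g⟩ := hg
  obtain ⟨y', hy', hyy', hy'h⟩ := hh
  refine ⟨x' + y', hx'.add hy', hxx'.add hyy' (integrableOn_of_ac hx.1) (integrableOn_of_ac hy.1)
    (integrableOn_of_ac hx'.1) (integrableOn_of_ac hy'.1), ?_⟩
  exact (hx'g.add hy'h (integrableOn_of_ac hx'.1) (integrableOn_of_ac hy'.1) (integrableOn_L2 g)
    (integrableOn_L2 h)).congr EventuallyEq.rfl (Lp.coeFn_add g h).symm

theorem HasSecondDeriv.smul {x : I → ℝ} {g : L2} (c : ℝ) (hg : HasSecondDeriv x g) :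
    HasSecondDeriv (c • x) (c • g) := by
  obtain ⟨x', hx', hxx', hx'g⟩ := hg
  exact ⟨c • x', hx'.smul c, hxx'.smul c,
    (hx'g.smul c).congr EventuallyEq.rfl (Lp.coeFn_smul c g).symm⟩

/-- The linear subspace `H² ∩ H¹₀` of the functions on `[0,1]`. -/
def dirichletSubmodule : Submodule ℝ (I → ℝ) where
  carrier := {x | MemH2 x ∧ MemH10 x}
  add_mem' := fun ⟨h1, h2, h3, h4⟩ ⟨k1, k2, k3, k4⟩ =>
    ⟨h1.add k1, h2.add k2, by simp [h3, k3], by simp [h4, k4]⟩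
  zero_mem' := ⟨MemH2.zero, MemH1.zero, rfl, rfl⟩
  smul_mem' := fun c _ ⟨h1, h2, h3, h4⟩ => ⟨h1.smul c, h2.smul c, by simp [h3], by simp [h4]⟩

/-- The space `𝕏 = H² ∩ H¹₀`. A type of its own, so that its topology is the one of the norm below,
not that of pointwise convergence. -/
def DirichletSpace : Type := dirichletSubmodule

namespace DirichletSpace

noncomputable instance : AddCommGroup DirichletSpace :=
  inferInstanceAs (AddCommGroup dirichletSubmodule)

noncomputable instance : Module ℝ DirichletSpace := inferInstanceAs (Module ℝ dirichletSubmodule)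

/-- The underlying function on `[0,1]`. -/
def toFun (x : DirichletSpace) : I → ℝ := x.1

/-- The second weak derivative of an element of `𝕏`; it is unique by `HasSecondDeriv.unique`. -/
noncomputable def secondDeriv (x : DirichletSpace) : L2 := x.2.1.exists_hasSecondDeriv.choose

theorem hasSecondDeriv (x : DirichletSpace) : HasSecondDeriv x.toFun x.secondDeriv :=
  x.2.1.exists_hasSecondDeriv.choose_spec

/-- `x ↦ ẍ` as a linear map. -/
noncomputable def secondDerivLM : DirichletSpace →ₗ[ℝ] L2 where
  toFun := secondDeriv
  map_add' x y := (hasSecondDeriv (x + y)).unique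
    ((hasSecondDeriv x).add (hasSecondDeriv y) x.2.1.1 y.2.1.1)
  map_smul' c x := (hasSecondDeriv (c • x)).unique ((hasSecondDeriv x).smul c)

theorem secondDerivLM_injective : Function.Injective secondDerivLM := by
  refine (injective_iff_map_eq_zero _).2 fun x hx => ?_
  obtain ⟨y, hy, hxy, hyg⟩ := hasSecondDeriv x
  have hx0 : x.secondDeriv = 0 := hx
  rw [hx0] at hyg
  have hyc : ∀ t ∈ Icc (0 : ℝ) 1, extend y t = extend y 0 := by
    intro t ht
    have h := hyg.integral_eq hy.1 (integrableOn_L2 0) ht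
    have h0 : ∫ s in (0 : ℝ)..t, (0 : L2) s = 0 := by
      rw [intervalIntegral.integral_of_le ht.1, integral_Ioc_eq_integral_Ioo]
      refine integral_eq_zero_of_ae (ae_restrict_of_ae_restrict_of_subset
        (Ioo_subset_Ioo_right ht.2) (Lp.coeFn_zero ℝ 2 _))
    linarith
  have hxt : ∀ t ∈ Icc (0 : ℝ) 1, extend x.toFun t = t * extend y 0 := by
    intro t ht
    have h : ∫ s in (0 : ℝ)..t, extend y s = extend x.toFun t - extend x.toFun 0 :=
      hxy.integral_eq x.2.1.1.1 (integrableOn_of_ac hy.1) ht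
    have h0 : ∫ s in (0 : ℝ)..t, extend y s = ∫ s in (0 : ℝ)..t, extend y 0 := by
      refine intervalIntegral.integral_congr fun s hs => hyc s ?_
      rw [uIcc_of_le ht.1] at hs
      exact ⟨hs.1, hs.2.trans ht.2⟩
    have hz : extend x.toFun 0 = 0 := (extend_coe x.toFun 0).trans x.2.2.2.1
    rw [h0, intervalIntegral.integral_const, hz] at h
    simpa using h.symm
  have hy0 : extend y 0 = 0 := by
    have h := hxt 1 (by simp)
    have h1 : extend x.toFun 1 = 0 := (extend_coe x.toFun 1).trans x.2.2.2.2
    linarith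
  refine Subtype.ext (funext fun t => ?_)
  have h := hxt t t.2
  rw [hy0, mul_zero, extend_coe] at h
  exact h

/-- The norm `‖x‖ = ‖ẍ‖` (norm of `L²(0,1)`) on `𝕏`. -/
noncomputable instance : NormedAddCommGroup DirichletSpace :=
  NormedAddCommGroup.induced DirichletSpace L2 secondDerivLM secondDerivLM_injective

noncomputable instance : NormedSpace ℝ DirichletSpace :=
  NormedSpace.induced ℝ DirichletSpace L2 secondDerivLM

theorem norm_eq (x : DirichletSpace) : ‖x‖ = ‖x.secondDeriv‖ := rfl

end DirichletSpace

theorem memLp_comp {f : ℝ → ℝ → ℝ}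
    (hf : ContinuousOn (Function.uncurry f) (Icc (0 : ℝ) 1 ×ˢ univ)) (x : DirichletSpace) :
    MemLp (fun t => f t (extend x.toFun t)) 2 (volume.restrict (Ioo (0 : ℝ) 1)) := by
  have hc : ContinuousOn (fun t => f t (extend x.toFun t)) (Icc 0 1) :=
    hf.comp (continuousOn_id.prodMk (continuousOn_of_ac x.2.1.1.1)) fun t ht => ⟨ht, mem_univ _⟩
  obtain ⟨C, hC⟩ := isCompact_Icc.exists_bound_of_continuousOn hc
  refine MemLp.of_bound ((hc.mono Ioo_subset_Icc_self).aestronglyMeasurable measurableSet_Ioo) C ?_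
  exact (ae_restrict_iff' measurableSet_Ioo).2
    (Eventually.of_forall fun t ht => hC t (Ioo_subset_Icc_self ht))

/-- The operator `(Tx)(t) = ẍ(t) - f(t, x(t))`, from `𝕏` to `L²(0,1)`. -/
noncomputable def dirichletOperator (f : ℝ → ℝ → ℝ)
    (hf : ContinuousOn (Function.uncurry f) (Icc (0 : ℝ) 1 ×ˢ univ)) (x : DirichletSpace) : L2 :=
  x.secondDeriv - (memLp_comp hf x).toLp (fun t => f t (extend x.toFun t))

/-- A `C¹` bijection with `C¹` inverse. -/
def IsDiffeomorphism {E F : Type*} [NormedAddCommGroup E] [NormedSpace ℝ E]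
    [NormedAddCommGroup F] [NormedSpace ℝ F] (T : E → F) : Prop :=
  ContDiff ℝ 1 T ∧ ∃ e : E ≃ F, ⇑e = T ∧ ContDiff ℝ 1 e.symm

end DirichletBVP

open scoped Topology RealInnerProductSpace

namespace DirichletBVP

/-! The second derivative is an isometry of `𝕏` onto `L²`, so `T` perturbs an isomorphism by the
superposition operator of `f`. Let `w = x - z`, `d = Tx - Tz` and `m = inf f_x`. Pairing `ẅ` with
`w` and integrating by parts gives `∫ẇ² = -∫wd - ∫w(f(t,x) - f(t,z)) ≤ ‖w‖_∞‖d‖ - m∫w²`. Wirtinger's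
inequality absorbs the last term because `-m < π²`, and `‖w‖_∞² ≤ ∫ẇ²`, so `‖w‖_∞ ≤ C‖d‖`
(`semilinearOperator_estimate`). Hence `T` is injective with closed range.

The derivative of `T` at `x` is `w ↦ ẅ - f_x(·,x)w`, an operator of the same kind with the same
lower bound `m`. The estimate applies to it, and its symmetry then makes it bijective
(`linearOperator_bijective`). By the inverse function theorem `T` is open with a `C¹` inverse on its
range. That range is open, closed and nonempty in the connected space `L²`, hence everything. -/

/-! ### Integrals over the unit interval -/

theorem integrableOn_iff_intervalIntegrable_unit {g : ℝ → ℝ} :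
    IntegrableOn g (Ioo 0 1) ↔ IntervalIntegrable g volume 0 1 :=
  (intervalIntegrable_iff_integrableOn_Ioo_of_le zero_le_one).symm

theorem integral_Ioo_unit (g : ℝ → ℝ) : ∫ t in Ioo (0 : ℝ) 1, g t = ∫ t in (0 : ℝ)..1, g t := by
  rw [intervalIntegral.integral_of_le zero_le_one, integral_Ioc_eq_integral_Ioo]

theorem intervalIntegral_congr_ae_unit {g h : ℝ → ℝ}
    (e : g =ᵐ[volume.restrict (Ioo 0 1)] h) : ∫ t in (0 : ℝ)..1, g t = ∫ t in (0 : ℝ)..1, h t := by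
  rw [← integral_Ioo_unit, ← integral_Ioo_unit]
  exact integral_congr_ae e

theorem continuous_of_ac {x : I → ℝ} (hx : AbsolutelyContinuousOnInterval (extend x) 0 1) :
    Continuous x := by
  have h := (continuousOn_of_ac hx).domRestrict
  refine h.congr fun t => ?_
  exact extend_coe x t

theorem continuous_extend {x : I → ℝ} (hx : Continuous x) : Continuous (extend x) :=
  hx.Icc_extend'

/-- An indefinite integral is absolutely continuous, with the integrand as its weak derivative. -/
theorem ac_hasWeakDeriv_integral {g : ℝ → ℝ} (hg : IntervalIntegrable g volume 0 1) (c : ℝ)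
    {u : ℝ → ℝ} (hu : ∀ t ∈ Icc (0 : ℝ) 1, u t = c + ∫ s in (0 : ℝ)..t, g s) :
    AbsolutelyContinuousOnInterval u 0 1 ∧ HasWeakDeriv u g := by
  have h1 := hg.absolutelyContinuousOnInterval_intervalIntegral (c := 0) (by simp)
  have h2 : AbsolutelyContinuousOnInterval (fun t => c + ∫ s in (0 : ℝ)..t, g s) 0 1 :=
    ((LipschitzWith.const c).lipschitzOnWith.absolutelyContinuousOnInterval
      (f := fun _ : ℝ => c)).add h1
  have hd : deriv (fun t => c + ∫ s in (0 : ℝ)..t, g s) =ᵐ[volume.restrict (Ioo 0 1)] g := by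
    refine (ae_restrict_iff' measurableSet_Ioo).2 ?_
    filter_upwards [hg.ae_hasDerivAt_integral] with t ht h
    have ht' : t ∈ uIcc (0 : ℝ) 1 := by
      rw [uIcc_of_le zero_le_one]; exact Ioo_subset_Icc_self h
    exact ((ht ht' 0 (by simp)).const_add c).deriv
  have e : (fun t => c + ∫ s in (0 : ℝ)..t, g s) =ᵐ[volume.restrict (Ioo 0 1)] u :=
    (ae_restrict_iff' measurableSet_Ioo).2
      (Eventually.of_forall fun t ht => (hu t (Ioo_subset_Icc_self ht)).symm)
  refine ⟨?_, (hasWeakDeriv_deriv h2).congr e hd⟩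
  -- The two functions agree only on `[0,1]`. The ε-δ condition sees only intervals with endpoints
  -- there, so it transfers.
  have h3 := h2
  rw [absolutelyContinuousOnInterval_iff] at h3 ⊢
  intro ε hε
  obtain ⟨δ, hδ, H⟩ := h3 ε hε
  refine ⟨δ, hδ, fun E hE hlt => ?_⟩
  have := H E hE hlt
  convert this using 4 with i hi
  · have hh := hE.1 i hi
    rw [uIcc_of_le zero_le_one] at hh
    exact hu _ hh.1
  · have hh := hE.1 i hi
    rw [uIcc_of_le zero_le_one] at hh
    exact hu _ hh.2

/-! ### Calculus in `𝕏`: integration by parts, Wirtinger's inequality, solvability of `ẍ = g` -/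

namespace DirichletSpace

/-- The first derivative of an element of `𝕏`. -/
noncomputable def firstDeriv (x : DirichletSpace) : I → ℝ := x.hasSecondDeriv.choose

theorem memH1_firstDeriv (x : DirichletSpace) : MemH1 x.firstDeriv :=
  x.hasSecondDeriv.choose_spec.1

theorem hasWeakDeriv_firstDeriv (x : DirichletSpace) :
    HasWeakDeriv (extend x.toFun) (extend x.firstDeriv) :=
  x.hasSecondDeriv.choose_spec.2.1

theorem hasWeakDeriv_secondDeriv (x : DirichletSpace) :
    HasWeakDeriv (extend x.firstDeriv) x.secondDeriv :=
  x.hasSecondDeriv.choose_spec.2.2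

theorem continuous_toFun (x : DirichletSpace) : Continuous x.toFun :=
  continuous_of_ac x.2.1.1.1

theorem continuous_firstDeriv (x : DirichletSpace) : Continuous x.firstDeriv :=
  continuous_of_ac x.memH1_firstDeriv.1

theorem extend_toFun_zero (x : DirichletSpace) : extend x.toFun 0 = 0 :=
  (extend_coe x.toFun 0).trans x.2.2.2.1

theorem extend_toFun_one (x : DirichletSpace) : extend x.toFun 1 = 0 :=
  (extend_coe x.toFun 1).trans x.2.2.2.2

theorem integral_firstDeriv (x : DirichletSpace) {t : ℝ} (ht : t ∈ Icc (0 : ℝ) 1) :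
    ∫ s in (0 : ℝ)..t, extend x.firstDeriv s = extend x.toFun t := by
  have h : ∫ s in (0 : ℝ)..t, extend x.firstDeriv s = extend x.toFun t - extend x.toFun 0 :=
    x.hasWeakDeriv_firstDeriv.integral_eq x.2.1.1.1 (integrableOn_of_ac x.memH1_firstDeriv.1) ht
  rw [h, x.extend_toFun_zero, sub_zero]

theorem hasDerivAt_toFun (x : DirichletSpace) {t : ℝ} (ht : t ∈ Ioo (0 : ℝ) 1) :
    HasDerivAt (extend x.toFun) (extend x.firstDeriv t) t := by
  have h := ((continuous_extend x.continuous_firstDeriv).integral_hasStrictDerivAt 0 t).hasDerivAt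
  refine h.congr_of_eventuallyEq ?_
  filter_upwards [Icc_mem_nhds ht.1 ht.2] with s hs
  exact (x.integral_firstDeriv hs).symm

/-- The boundary terms vanish because `z` does at both endpoints; nothing is needed of `ẋ` there. -/
theorem integral_toFun_mul_secondDeriv (x z : DirichletSpace) :
    ∫ t in (0 : ℝ)..1, extend z.toFun t * x.secondDeriv t =
      -∫ t in (0 : ℝ)..1, extend z.firstDeriv t * extend x.firstDeriv t := by
  have h := AbsolutelyContinuousOnInterval.integral_mul_deriv_eq_deriv_mul
    (f := extend z.toFun) (g := extend x.firstDeriv) z.2.1.1.1 x.memH1_firstDeriv.1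
  rw [extend_toFun_zero, extend_toFun_one] at h
  have e1 := x.hasWeakDeriv_secondDeriv.unique (hasWeakDeriv_deriv x.memH1_firstDeriv.1)
    (integrableOn_L2 _) (integrableOn_deriv x.memH1_firstDeriv.1)
  have e2 := z.hasWeakDeriv_firstDeriv.unique (hasWeakDeriv_deriv z.2.1.1.1)
    (integrableOn_of_ac z.memH1_firstDeriv.1) (integrableOn_deriv z.2.1.1.1)
  have a1 : ∫ t in (0 : ℝ)..1, extend z.toFun t * x.secondDeriv t =
      ∫ t in (0 : ℝ)..1, extend z.toFun t * deriv (extend x.firstDeriv) t :=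
    intervalIntegral_congr_ae_unit (by filter_upwards [e1] with t ht; rw [ht])
  have a2 : ∫ t in (0 : ℝ)..1, extend z.firstDeriv t * extend x.firstDeriv t =
      ∫ t in (0 : ℝ)..1, deriv (extend z.toFun) t * extend x.firstDeriv t :=
    intervalIntegral_congr_ae_unit (by filter_upwards [e2] with t ht; rw [ht])
  rw [a1, a2, h]
  ring

/-- The Dirichlet energy `∫ ẋ²`. -/
noncomputable def energy (x : DirichletSpace) : ℝ :=
  ∫ t in (0 : ℝ)..1, extend x.firstDeriv t ^ 2

/-- With `c = x(t) = ∫₀ᵗ ẋ`, expanding `∫₀ᵗ (ẋ - c)² ≥ 0` gives `(2 - t)c² ≤ ∫₀ᵗ ẋ²`, and `t ≤ 1`.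
-/
theorem sq_toFun_le_energy (x : DirichletSpace) (t : I) : x.toFun t ^ 2 ≤ x.energy := by
  have hc := continuous_extend x.continuous_firstDeriv
  set c := x.toFun t with hcdef
  have h1 : ∫ s in (0 : ℝ)..t, extend x.firstDeriv s = c := by
    rw [x.integral_firstDeriv t.2, extend_coe]
  have h2 : 0 ≤ ∫ s in (0 : ℝ)..t, (extend x.firstDeriv s - c) ^ 2 :=
    intervalIntegral.integral_nonneg t.2.1 fun s _ => sq_nonneg _
  have h3 : ∫ s in (0 : ℝ)..t, (extend x.firstDeriv s - c) ^ 2 =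
      (∫ s in (0 : ℝ)..t, extend x.firstDeriv s ^ 2) - 2 * c * c + t * c ^ 2 := by
    have : ∀ s, (extend x.firstDeriv s - c) ^ 2 =
        extend x.firstDeriv s ^ 2 - 2 * c * extend x.firstDeriv s + c ^ 2 := fun s => by ring
    simp_rw [this]
    rw [intervalIntegral.integral_add (Continuous.intervalIntegrable (by fun_prop) _ _)
      (by simp), intervalIntegral.integral_sub (Continuous.intervalIntegrable (by fun_prop) _ _)
      (Continuous.intervalIntegrable (by fun_prop) _ _), intervalIntegral.integral_const_mul, h1]
    simp
  have h4 : ∫ s in (0 : ℝ)..t, extend x.firstDeriv s ^ 2 ≤ x.energy := by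
    refine intervalIntegral.integral_mono_interval le_rfl t.2.1 t.2.2
      (Eventually.of_forall fun s => sq_nonneg _) (Continuous.intervalIntegrable (by fun_prop) _ _)
  have := t.2.2
  nlinarith [sq_nonneg c]

/-- Wirtinger's inequality, with any constant below the optimal one. -/
theorem sq_mul_integral_le_energy (x : DirichletSpace) {μ : ℝ} (h0 : 0 < μ) (hμ : μ < Real.pi) :
    μ ^ 2 * ∫ t in (0 : ℝ)..1, extend x.toFun t ^ 2 ≤ x.energy := by
  have hcu := continuous_extend x.continuous_toFun
  have hcv := continuous_extend x.continuous_firstDeriv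
  set u := extend x.toFun
  set v := extend x.firstDeriv
  -- `p` is the logarithmic derivative of `cos(μ(t - 1/2))`, which is positive on `[0,1]` since `μ <
  -- π`. It solves the Riccati equation `p' = -μ² - p²`, so `(ẋ - xp)² = ẋ² - (x²p)' - μ²x²`, and
  -- `x²p` vanishes at both ends.
  let p : ℝ → ℝ := fun t => -μ * Real.tan (μ * (t - 1 / 2))
  have hcos : ∀ t ∈ Icc (0 : ℝ) 1, Real.cos (μ * (t - 1 / 2)) ≠ 0 := fun t ht =>
    (Real.cos_pos_of_mem_Ioo ⟨by nlinarith [ht.1, ht.2], by nlinarith [ht.1, ht.2]⟩).ne'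
  have hp : ∀ t ∈ Icc (0 : ℝ) 1, HasDerivAt p (-μ ^ 2 - p t ^ 2) t := by
    intro t ht
    have h1 : HasDerivAt (fun t => μ * (t - 1 / 2)) μ t :=
      (((hasDerivAt_id t).sub_const (1 / 2)).const_mul μ).congr_deriv (mul_one μ)
    have h2 := ((Real.hasDerivAt_tan (hcos t ht)).comp t h1).const_mul (-μ)
    refine h2.congr_deriv ?_
    simp only [p, Real.tan_eq_sin_div_cos]
    have h3 := hcos t ht
    generalize μ * (t - 1 / 2) = θ at h3 ⊢
    have h4 := Real.sin_sq_add_cos_sq θ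
    field_simp
    linear_combination h4
  have hpc : ContinuousOn p (Icc 0 1) := fun t ht => (hp t ht).continuousAt.continuousWithinAt
  have hII : ∀ {g : ℝ → ℝ}, ContinuousOn g (Icc 0 1) → IntervalIntegrable g volume 0 1 :=
    fun hg => ContinuousOn.intervalIntegrable (by rwa [uIcc_of_le zero_le_one])
  have hu' := hcu.continuousOn (s := Icc 0 1)
  have hv' := hcv.continuousOn (s := Icc 0 1)
  have hdc : ContinuousOn (fun t => 2 * u t * v t * p t + u t ^ 2 * (-μ ^ 2 - p t ^ 2))
    (Icc 0 1) := by fun_prop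
  have key : ∫ t in (0 : ℝ)..1, (2 * u t * v t * p t + u t ^ 2 * (-μ ^ 2 - p t ^ 2)) = 0 := by
    rw [intervalIntegral.integral_eq_sub_of_hasDerivAt_of_le (f := fun t => u t ^ 2 * p t)
      zero_le_one (by fun_prop) ?_ (hII hdc)]
    · simp [u, x.extend_toFun_zero, x.extend_toFun_one]
    · intro t ht
      refine (((x.hasDerivAt_toFun ht).pow 2).mul (hp t (Ioo_subset_Icc_self ht))).congr_deriv ?_
      simp [u, v]
  have hnn : 0 ≤ ∫ t in (0 : ℝ)..1, (v t - u t * p t) ^ 2 :=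
    intervalIntegral.integral_nonneg zero_le_one fun s _ => sq_nonneg _
  have e : ∫ t in (0 : ℝ)..1, (v t - u t * p t) ^ 2 = x.energy
      - (∫ t in (0 : ℝ)..1, (2 * u t * v t * p t + u t ^ 2 * (-μ ^ 2 - p t ^ 2)))
      - μ ^ 2 * ∫ t in (0 : ℝ)..1, u t ^ 2 := by
    have e0 : x.energy = ∫ t in (0 : ℝ)..1, v t ^ 2 := rfl
    rw [e0, ← intervalIntegral.integral_sub (hII (by fun_prop)) (hII hdc),
      ← intervalIntegral.integral_const_mul,
      ← intervalIntegral.integral_sub ((hII (by fun_prop)).sub (hII hdc)) (hII (by fun_prop))]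
    congr 1
    ext t
    ring
  rw [key] at e
  linarith

/-- Every function in `L²(0,1)` is the second derivative of an element of `𝕏`. -/
theorem secondDerivLM_surjective : Function.Surjective secondDerivLM := by
  intro g
  have hg := integrableOn_iff_intervalIntegrable_unit.1 (integrableOn_L2 g)
  let G : ℝ → ℝ := fun t => ∫ s in (0 : ℝ)..t, g s
  -- The initial slope is forced by the condition `x(1) = ∫₀¹ (c + G) = 0`.
  let c : ℝ := -∫ t in (0 : ℝ)..1, G t
  let y : I → ℝ := fun t => c + G t
  have hy := ac_hasWeakDeriv_integral hg c (u := extend y)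
    fun t ht => extend_coe y ⟨t, ht⟩
  have hyH : MemH1 y := ⟨hy.1, g, hy.2⟩
  have hyc := continuous_extend (continuous_of_ac hy.1)
  let x : I → ℝ := fun t => 0 + ∫ s in (0 : ℝ)..t, extend y s
  have hx := ac_hasWeakDeriv_integral (hyc.intervalIntegrable 0 1) 0 (u := extend x)
    fun t ht => extend_coe x ⟨t, ht⟩
  have hyL : MemLp (extend y) 2 (volume.restrict (Ioo (0 : ℝ) 1)) := by
    obtain ⟨C, hC⟩ := isCompact_Icc.exists_bound_of_continuousOn (hyc.continuousOn (s := Icc 0 1))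
    refine MemLp.of_bound hyc.aestronglyMeasurable C ?_
    exact (ae_restrict_iff' measurableSet_Ioo).2
      (Eventually.of_forall fun t ht => hC t (Ioo_subset_Icc_self ht))
  have hxH : MemH1 x := ⟨hx.1, hyL.toLp _, hx.2.congr EventuallyEq.rfl hyL.coeFn_toLp.symm⟩
  have hx1 : x 1 = 0 := by
    have e : ∫ s in (0 : ℝ)..1, extend y s = ∫ s in (0 : ℝ)..1, (c + G s) := by
      refine intervalIntegral.integral_congr fun s hs => ?_
      rw [uIcc_of_le zero_le_one] at hs
      exact extend_coe y ⟨s, hs⟩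
    have hGc : IntervalIntegrable G volume 0 1 :=
      (hg.absolutelyContinuousOnInterval_intervalIntegral (c := 0)
        (by simp)).continuousOn.intervalIntegrable
    simp only [x, Icc.coe_one, e]
    rw [intervalIntegral.integral_add (by simp) hGc]
    simp [c]
  let X : DirichletSpace := ⟨x, ⟨hxH, y, hyH, hx.2⟩, hxH, by simp [x], hx1⟩
  exact ⟨X, (hasSecondDeriv X).unique ⟨y, hyH, hx.2, hy.2⟩⟩

end DirichletSpace

end DirichletBVP

namespace DirichletBVP

/-! ### Continuous functions inside `L²` -/

theorem memLp_extend (a : C(I, ℝ)) : MemLp (extend a) 2 (volume.restrict (Ioo (0 : ℝ) 1)) :=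
  MemLp.of_bound (continuous_extend a.continuous).aestronglyMeasurable ‖a‖
    (Eventually.of_forall fun t => a.norm_coe_le_norm (projIcc 0 1 zero_le_one t))

/-- The inclusion of the continuous functions into `L²(0,1)`. -/
noncomputable def toL2 : C(I, ℝ) →L[ℝ] L2 :=
  LinearMap.mkContinuous
    { toFun := fun a => (memLp_extend a).toLp _
      map_add' := fun a b => MemLp.toLp_add (memLp_extend a) (memLp_extend b)
      map_smul' := fun c a => MemLp.toLp_const_smul c (memLp_extend a) } 1 (fun a => by
        have h := Lp.norm_le_of_ae_bound (f := (memLp_extend a).toLp _) (norm_nonneg a)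
          (by
            filter_upwards [(memLp_extend a).coeFn_toLp] with t ht
            rw [ht]
            exact a.norm_coe_le_norm (projIcc 0 1 zero_le_one t))
        refine h.trans (le_of_eq ?_)
        simp [measureUnivNNReal])

theorem norm_toL2_le (a : C(I, ℝ)) : ‖toL2 a‖ ≤ ‖a‖ := by
  simpa using (toL2.le_of_opNorm_le (LinearMap.mkContinuous_norm_le _ zero_le_one _) a)

theorem coeFn_toL2 (a : C(I, ℝ)) : toL2 a =ᵐ[volume.restrict (Ioo 0 1)] extend a :=
  (memLp_extend a).coeFn_toLp

theorem inner_toL2 (a : C(I, ℝ)) (g : L2) :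
    ⟪toL2 a, g⟫ = ∫ t in (0 : ℝ)..1, extend a t * g t := by
  rw [L2.inner_def, ← integral_Ioo_unit]
  refine integral_congr_ae ?_
  filter_upwards [coeFn_toL2 a] with t ht
  rw [ht]
  simp [mul_comm]

theorem inner_toL2_toL2 (a b : C(I, ℝ)) :
    ⟪toL2 a, toL2 b⟫ = ∫ t in (0 : ℝ)..1, extend a t * extend b t := by
  rw [inner_toL2]
  refine intervalIntegral_congr_ae_unit ?_
  filter_upwards [coeFn_toL2 b] with t ht
  rw [ht]

theorem mul_norm_toL2_sq_le_inner {a b : C(I, ℝ)} {m : ℝ} (h : ∀ t, m * a t ^ 2 ≤ b t * a t) :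
    m * ‖toL2 a‖ ^ 2 ≤ ⟪toL2 a, toL2 b⟫ := by
  have ha := continuous_extend a.continuous
  have hb := continuous_extend b.continuous
  rw [← real_inner_self_eq_norm_sq, inner_toL2_toL2, inner_toL2_toL2,
    ← intervalIntegral.integral_const_mul]
  refine intervalIntegral.integral_mono_on zero_le_one
    (Continuous.intervalIntegrable (by fun_prop) _ _)
    (Continuous.intervalIntegrable (by fun_prop) _ _) fun t _ => ?_
  have := h (projIcc 0 1 zero_le_one t)
  simp only [extend, IccExtend, Function.comp_apply]
  linarith

/-! ### Completeness of `𝕏` and its embedding into the continuous functions -/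

namespace DirichletSpace

/-- The second derivative as an isometric isomorphism of `𝕏` onto `L²(0,1)`. -/
noncomputable def secondDerivLIE : DirichletSpace ≃ₗᵢ[ℝ] L2 where
  toLinearEquiv := LinearEquiv.ofBijective secondDerivLM
    ⟨secondDerivLM_injective, secondDerivLM_surjective⟩
  norm_map' _ := rfl

instance : CompleteSpace DirichletSpace :=
  (completeSpace_congr (e := secondDerivLIE.toEquiv)
    secondDerivLIE.isometry.isUniformEmbedding).2 inferInstance

/-- An element of `𝕏` as a continuous function. -/
def toContinuousMap (x : DirichletSpace) : C(I, ℝ) := ⟨x.toFun, x.continuous_toFun⟩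

theorem toContinuousMap_injective : Function.Injective toContinuousMap := fun _ _ h =>
  Subtype.ext (congrArg (fun a : C(I, ℝ) => (a : I → ℝ)) h)

/-- Both sides equal `-∫ẋż`. This symmetry identifies the orthogonal complement of the range of the
linearized operator. -/
theorem inner_toL2_secondDeriv_comm (x z : DirichletSpace) :
    ⟪toL2 z.toContinuousMap, x.secondDeriv⟫ = ⟪toL2 x.toContinuousMap, z.secondDeriv⟫ := by
  rw [inner_toL2, inner_toL2]
  refine (integral_toFun_mul_secondDeriv x z).trans
    (Eq.trans ?_ (integral_toFun_mul_secondDeriv z x).symm)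
  simp_rw [mul_comm]

theorem energy_eq (x : DirichletSpace) :
    x.energy = -⟪toL2 x.toContinuousMap, x.secondDeriv⟫ := by
  rw [inner_toL2]
  refine Eq.trans ?_ (congrArg Neg.neg (integral_toFun_mul_secondDeriv x x)).symm
  rw [neg_neg, energy]
  simp_rw [sq]

theorem norm_toContinuousMap_sq_le (x : DirichletSpace) : ‖x.toContinuousMap‖ ^ 2 ≤ x.energy := by
  have h : 0 ≤ x.energy := (sq_nonneg _).trans (x.sq_toFun_le_energy 0)
  have h1 : ‖x.toContinuousMap‖ ≤ √x.energy :=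
    (ContinuousMap.norm_le _ (Real.sqrt_nonneg _)).2 fun t =>
      Real.abs_le_sqrt (x.sq_toFun_le_energy t)
  exact (Real.le_sqrt (norm_nonneg _) h).1 h1

theorem sq_mul_norm_toL2_sq_le (x : DirichletSpace) {μ : ℝ} (h0 : 0 < μ) (hμ : μ < Real.pi) :
    μ ^ 2 * ‖toL2 x.toContinuousMap‖ ^ 2 ≤ x.energy := by
  rw [← real_inner_self_eq_norm_sq, inner_toL2_toL2]
  refine le_trans (le_of_eq ?_) (x.sq_mul_integral_le_energy h0 hμ)
  simp_rw [sq (extend _ _)]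
  rfl

/-- `‖x‖_∞² ≤ ∫ẋ² = -∫xẍ ≤ ‖x‖_∞‖ẍ‖`, and one factor cancels. -/
theorem norm_toContinuousMap_le (x : DirichletSpace) : ‖x.toContinuousMap‖ ≤ ‖x‖ := by
  have h1 := x.norm_toContinuousMap_sq_le
  have h2 : x.energy ≤ ‖x.toContinuousMap‖ * ‖x‖ := by
    rw [energy_eq]
    calc _ ≤ ‖toL2 x.toContinuousMap‖ * ‖x.secondDeriv‖ :=
          (neg_le_abs _).trans (abs_real_inner_le_norm _ _)
      _ ≤ _ := mul_le_mul_of_nonneg_right (norm_toL2_le _) (norm_nonneg _)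
  by_contra! h
  nlinarith [norm_nonneg x]

/-- The embedding of `𝕏` into the continuous functions. -/
noncomputable def toContinuousMapCLM : DirichletSpace →L[ℝ] C(I, ℝ) :=
  LinearMap.mkContinuous
    { toFun := toContinuousMap
      map_add' := fun _ _ => rfl
      map_smul' := fun _ _ => rfl } 1 fun x =>
      x.norm_toContinuousMap_le.trans_eq (one_mul _).symm

end DirichletSpace

/-! ### The a priori estimate, injectivity and closed range -/

open DirichletSpace

/-- The operator `x ↦ ẍ - F(x)` for a map `F` on the continuous functions. -/
noncomputable def semilinearOperator (F : C(I, ℝ) → C(I, ℝ)) (x : DirichletSpace) : L2 :=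
  secondDerivLIE x - toL2 (F (toContinuousMapCLM x))

/-- Stated for an abstract `F` so that it serves both the nonlinear operator and its linearizations.
-/
theorem semilinearOperator_estimate {F : C(I, ℝ) → C(I, ℝ)} {m : ℝ} (hm : -(Real.pi ^ 2) < m)
    (hF : ∀ a b t, m * (a t - b t) ^ 2 ≤ (F a t - F b t) * (a t - b t)) :
    ∃ C > 0, ∀ x z, ‖toContinuousMapCLM x - toContinuousMapCLM z‖ ≤
      C * ‖semilinearOperator F x - semilinearOperator F z‖ := by
  have hpi := Real.pi_pos
  -- Wirtinger's inequality holds with constant `r < π²`. The term `-m∫w²` then costs at most the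
  -- fraction `k/r < 1` of the energy, where `k = max(-m, 0)`, leaving `1 - k/r`.
  obtain ⟨r, hr1, hr2⟩ := exists_between
    (show max (-m) 0 < Real.pi ^ 2 from max_lt (by linarith) (by positivity))
  have hr0 : 0 < r := (le_max_right _ _).trans_lt hr1
  have hmr : -m ≤ max (-m) 0 := le_max_left _ _
  have hm0 : 0 ≤ max (-m) 0 := le_max_right _ _
  set k := max (-m) 0
  have hc : 0 < 1 - k / r := by rw [sub_pos, div_lt_one hr0]; exact hr1
  refine ⟨(1 - k / r)⁻¹, inv_pos.2 hc, fun x z => ?_⟩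
  rw [← map_sub]
  set w := x - z with hw
  set d := semilinearOperator F x - semilinearOperator F z with hd
  set N := toContinuousMapCLM w with hN
  have hW : r * ‖toL2 N‖ ^ 2 ≤ w.energy := by
    have := w.sq_mul_norm_toL2_sq_le (Real.sqrt_pos.2 hr0) ((Real.sqrt_lt' hpi).2 hr2)
    rwa [Real.sq_sqrt hr0.le] at this
  have hS : ‖N‖ ^ 2 ≤ w.energy := w.norm_toContinuousMap_sq_le
  have hD : w.secondDeriv =
      d + toL2 (F (toContinuousMapCLM x) - F (toContinuousMapCLM z)) := by
    change secondDerivLIE (x - z) = _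
    simp only [hd, semilinearOperator, map_sub]
    abel
  have hE : w.energy = -⟪toL2 N, d⟫
      - ⟪toL2 N, toL2 (F (toContinuousMapCLM x) - F (toContinuousMapCLM z))⟫ := by
    rw [energy_eq, hD, inner_add_right]
    change -(⟪toL2 N, d⟫ + _) = _
    rw [neg_add']
    rfl
  have h1 : -⟪toL2 N, d⟫ ≤ ‖N‖ * ‖d‖ :=
    ((neg_le_abs _).trans (abs_real_inner_le_norm _ _)).trans
      (mul_le_mul_of_nonneg_right (norm_toL2_le _) (norm_nonneg _))
  have h2 := mul_norm_toL2_sq_le_inner (a := N)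
    (b := F (toContinuousMapCLM x) - F (toContinuousMapCLM z)) (m := m) (fun t => by
      have := hF (toContinuousMapCLM x) (toContinuousMapCLM z) t
      simpa [hN, hw] using this)
  have h3 : k * ‖toL2 N‖ ^ 2 ≤ k / r * w.energy := by
    rw [div_mul_eq_mul_div, le_div_iff₀ hr0]
    nlinarith
  have h4 : (1 - k / r) * ‖N‖ ^ 2 ≤ ‖N‖ * ‖d‖ := by
    have h5 : -m * ‖toL2 N‖ ^ 2 ≤ k * ‖toL2 N‖ ^ 2 :=
      mul_le_mul_of_nonneg_right hmr (sq_nonneg _)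
    have h6 := mul_le_mul_of_nonneg_left hS hc.le
    linarith
  rw [inv_mul_eq_div, le_div_iff₀ hc]
  rcases (norm_nonneg N).eq_or_lt with h0 | h0
  · rw [← h0, zero_mul]; positivity
  · nlinarith

theorem semilinearOperator_injective {F : C(I, ℝ) → C(I, ℝ)} {m : ℝ} (hm : -(Real.pi ^ 2) < m)
    (hF : ∀ a b t, m * (a t - b t) ^ 2 ≤ (F a t - F b t) * (a t - b t)) :
    Function.Injective (semilinearOperator F) := by
  obtain ⟨C, _, hC⟩ := semilinearOperator_estimate hm hF
  intro x z h
  have := hC x z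
  rw [h, sub_self, norm_zero, mul_zero, norm_le_zero_iff, sub_eq_zero] at this
  exact toContinuousMap_injective this

theorem continuous_semilinearOperator {F : C(I, ℝ) → C(I, ℝ)} (hF : Continuous F) :
    Continuous (semilinearOperator F) :=
  secondDerivLIE.continuous.sub (toL2.continuous.comp (hF.comp toContinuousMapCLM.continuous))

/-- If `Txₙ` converges, the estimate makes `xₙ` uniformly Cauchy. Then `F(xₙ)` converges, hence so
does `ẍₙ = Txₙ + F(xₙ)`, which is convergence in `𝕏`. -/
theorem isClosed_range_semilinearOperator {F : C(I, ℝ) → C(I, ℝ)} {m : ℝ}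
    (hm : -(Real.pi ^ 2) < m)
    (hF : ∀ a b t, m * (a t - b t) ^ 2 ≤ (F a t - F b t) * (a t - b t)) (hFc : Continuous F) :
    IsClosed (range (semilinearOperator F)) := by
  obtain ⟨C, hC0, hC⟩ := semilinearOperator_estimate hm hF
  refine isClosed_of_closure_subset fun h hh => ?_
  obtain ⟨y, hy, hlim⟩ := mem_closure_iff_seq_limit.1 hh
  choose x hx using hy
  have hcauchy : CauchySeq fun n => toContinuousMapCLM (x n) := by
    rw [Metric.cauchySeq_iff']
    intro ε hε
    obtain ⟨N, hN⟩ := Metric.cauchySeq_iff'.1 hlim.cauchySeq (ε / C) (by positivity)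
    refine ⟨N, fun n hn => ?_⟩
    have h1 := hN n hn
    rw [dist_eq_norm, ← hx, ← hx, lt_div_iff₀' hC0] at h1
    rw [dist_eq_norm]
    exact (hC _ _).trans_lt h1
  obtain ⟨a, ha⟩ := cauchySeq_tendsto_of_complete hcauchy
  have hD : Tendsto (fun n => secondDerivLIE (x n)) atTop (𝓝 (h + toL2 (F a))) := by
    refine (hlim.add (((toL2.continuous.comp hFc).tendsto a).comp ha)).congr fun n => ?_
    rw [← hx n]
    simp [semilinearOperator]
  have hX := (secondDerivLIE.symm.continuous.tendsto _).comp hD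
  refine ⟨_, tendsto_nhds_unique (((continuous_semilinearOperator hFc).tendsto _).comp hX)
    (hlim.congr fun n => ?_)⟩
  simp [hx n]

/-! ### The linearized problem -/

/-- The operator `x ↦ ẍ - q x` for a continuous function `q`. -/
noncomputable def linearOperator (q : C(I, ℝ)) : DirichletSpace →L[ℝ] L2 :=
  (secondDerivLIE : DirichletSpace ≃L[ℝ] L2).toContinuousLinearMap -
    toL2 ∘L ContinuousLinearMap.mul ℝ C(I, ℝ) q ∘L toContinuousMapCLM

/-- The range is closed, so it suffices that its orthogonal complement is zero. By symmetry that
complement lies in the kernel, which is trivial. -/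
theorem linearOperator_bijective {q : C(I, ℝ)} {m : ℝ} (hm : -(Real.pi ^ 2) < m)
    (hq : ∀ t, m ≤ q t) : Function.Bijective (linearOperator q) := by
  have hF : ∀ (a b : C(I, ℝ)) t,
      m * (a t - b t) ^ 2 ≤ ((q * a) t - (q * b) t) * (a t - b t) := fun a b t => by
    simp only [ContinuousMap.mul_apply]
    nlinarith [mul_le_mul_of_nonneg_right (hq t) (sq_nonneg (a t - b t))]
  have hinj : Function.Injective (linearOperator q) := semilinearOperator_injective hm hF
  refine ⟨hinj, ?_⟩
  have hcl : IsClosed ((linearOperator q).range : Set L2) :=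
    isClosed_range_semilinearOperator hm hF (continuous_const.mul continuous_id)
  have horth : ((linearOperator q).range)ᗮ = ⊥ := by
    refine (Submodule.eq_bot_iff _).2 fun v hv => ?_
    have hv' : ∀ x, ⟪linearOperator q x, v⟫ = 0 := fun x => hv _ ⟨x, rfl⟩
    have hqv : MemLp (fun t => extend q t * v t) 2 (volume.restrict (Ioo (0 : ℝ) 1)) := by
      refine MemLp.of_le_mul (c := ‖q‖) (Lp.memLp v)
        ((continuous_extend q.continuous).aestronglyMeasurable.mul
          (Lp.aestronglyMeasurable v)) (Eventually.of_forall fun t => ?_)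
      rw [norm_mul]
      exact mul_le_mul_of_nonneg_right (q.norm_coe_le_norm (projIcc 0 1 zero_le_one t))
        (norm_nonneg _)
    -- Regularity of `v`: solve `z̈ = qv`. For every `x`, `⟪ẍ, v⟫ = ⟪qx, v⟫ = ⟪x, z̈⟫ = ⟪z, ẍ⟫`. As
    -- `ẍ` runs over all of `L²`, `v = z`, so `z̈ = qz`.
    obtain ⟨z, hz⟩ := secondDerivLIE.surjective (hqv.toLp _)
    have e1 : ∀ x : DirichletSpace,
        ⟪toL2 (q * x.toContinuousMap), v⟫ = ⟪toL2 z.toContinuousMap, x.secondDeriv⟫ := by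
      intro x
      rw [inner_toL2_secondDeriv_comm, show z.secondDeriv = hqv.toLp _ from hz, inner_toL2,
        inner_toL2]
      refine intervalIntegral_congr_ae_unit ?_
      filter_upwards [hqv.coeFn_toLp] with t ht
      rw [ht]
      simp only [extend, IccExtend, Function.comp_apply, ContinuousMap.mul_apply]
      ring
    have e2 : v = toL2 z.toContinuousMap := by
      refine ext_inner_left ℝ fun g => ?_
      obtain ⟨x, rfl⟩ := secondDerivLIE.surjective g
      have h := hv' x
      have e : linearOperator q x = secondDerivLIE x - toL2 (q * x.toContinuousMap) := rfl
      rw [e, inner_sub_left, e1, sub_eq_zero] at h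
      rw [h, real_inner_comm]
      rfl
    have e3 : linearOperator q z = 0 := by
      have e : linearOperator q z = secondDerivLIE z - toL2 (q * z.toContinuousMap) := rfl
      rw [e, hz, sub_eq_zero]
      refine Lp.ext ?_
      have hvz := coeFn_toL2 z.toContinuousMap
      rw [← e2] at hvz
      filter_upwards [hqv.coeFn_toLp, coeFn_toL2 (q * z.toContinuousMap), hvz] with t h1 h2 h3
      rw [h1, h2, h3]
      rfl
    have hz0 : z = 0 := hinj (e3.trans (map_zero _).symm)
    rw [e2, hz0]
    exact (congrArg toL2 (map_zero toContinuousMapCLM)).trans (map_zero _)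
  have htop := Submodule.topologicalClosure_eq_top_iff.2 horth
  rw [hcl.submodule_topologicalClosure_eq] at htop
  exact LinearMap.range_eq_top.1 htop

/-! ### Differentiability of the superposition operator -/

/-- The superposition operator `a ↦ g(·, a(·))` on the continuous functions. -/
noncomputable def superposition (g : ℝ → ℝ → ℝ)
    (hg : ContinuousOn (Function.uncurry g) (Icc (0 : ℝ) 1 ×ˢ univ)) (a : C(I, ℝ)) : C(I, ℝ) where
  toFun t := g t (a t)
  continuous_toFun := hg.comp_continuous (f := fun t : I => ((t : ℝ), a t)) (by fun_prop)
    fun t => ⟨t.2, mem_univ _⟩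

theorem superposition_apply {g : ℝ → ℝ → ℝ}
    (hg : ContinuousOn (Function.uncurry g) (Icc (0 : ℝ) 1 ×ˢ univ)) (a : C(I, ℝ)) (t : I) :
    superposition g hg a t = g t (a t) := rfl

theorem continuous_superposition {g : ℝ → ℝ → ℝ}
    (hg : ContinuousOn (Function.uncurry g) (Icc (0 : ℝ) 1 ×ˢ univ)) :
    Continuous (superposition g hg) := by
  refine ContinuousMap.continuous_of_continuous_uncurry _ ?_
  exact hg.comp_continuous (f := fun p : C(I, ℝ) × I => ((p.2 : ℝ), p.1 p.2)) (by fun_prop)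
    fun p => ⟨p.2.2, mem_univ _⟩

theorem hasFDerivAt_superposition {f fx : ℝ → ℝ → ℝ}
    (hf : ContinuousOn (Function.uncurry f) (Icc (0 : ℝ) 1 ×ˢ univ))
    (hderiv : ∀ t ∈ Icc (0 : ℝ) 1, ∀ x : ℝ, HasDerivAt (f t) (fx t x) x)
    (hfx : ContinuousOn (Function.uncurry fx) (Icc (0 : ℝ) 1 ×ˢ univ)) (a : C(I, ℝ)) :
    HasFDerivAt (superposition f hf)
      (ContinuousLinearMap.mul ℝ C(I, ℝ) (superposition fx hfx a)) a := by
  rw [hasFDerivAt_iff_isLittleO_nhds_zero, Asymptotics.isLittleO_iff]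
  intro ε hε
  -- Continuity of the superposition operator of `fx` in the sup norm gives one `δ` for all `t`.
  obtain ⟨δ, hδ, H⟩ := Metric.continuous_iff.1 (continuous_superposition hfx) a ε hε
  filter_upwards [Metric.ball_mem_nhds (0 : C(I, ℝ)) hδ] with w hw
  rw [mem_ball_zero_iff] at hw
  refine (ContinuousMap.norm_le _ (by positivity)).2 fun t => ?_
  -- Mean value inequality along the segment from `a t` to `a t + w t`, with the linear part
  -- subtracted; the increment over `[0,1]` is the Taylor remainder.
  have hd : ∀ s ∈ Icc (0 : ℝ) 1, HasDerivWithinAt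
      (fun s : ℝ => f t (a t + s * w t) - s * (fx t (a t) * w t))
      ((fx t (a t + s * w t) - fx t (a t)) * w t) (Icc 0 1) s := by
    intro s _
    have h1 : HasDerivAt (fun s : ℝ => a t + s * w t) (w t) s := by
      simpa using ((hasDerivAt_id s).mul_const (w t)).const_add (a t)
    have h2 := (hderiv t t.2 (a t + s * w t)).comp s h1
    have h3 := (hasDerivAt_id s).mul_const (fx t (a t) * w t)
    refine (h2.sub h3).hasDerivWithinAt.congr_deriv ?_
    ring
  have hb : ∀ s ∈ Icc (0 : ℝ) 1,
      ‖(fx t (a t + s * w t) - fx t (a t)) * w t‖ ≤ ε * ‖w‖ := by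
    intro s hs
    have h1 : dist (a + s • w) a < δ := by
      rw [dist_eq_norm, add_sub_cancel_left, norm_smul, Real.norm_of_nonneg hs.1]
      exact (mul_le_of_le_one_left (norm_nonneg _) hs.2).trans_lt hw
    have h2 := (ContinuousMap.dist_apply_le_dist t).trans (H _ h1).le
    rw [norm_mul]
    exact mul_le_mul (by simpa [dist_eq_norm, superposition_apply] using h2) (w.norm_coe_le_norm t)
      (norm_nonneg _) hε.le
  have := (convex_Icc (0 : ℝ) 1).norm_image_sub_le_of_norm_hasDerivWithin_le hd hb
    (left_mem_Icc.2 zero_le_one) (right_mem_Icc.2 zero_le_one)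
  simp only [one_mul, zero_mul, sub_zero, add_zero, norm_one, mul_one] at this
  refine le_of_eq_of_le (congrArg norm ?_) this
  change f t (a t + w t) - f t (a t) - fx t (a t) * w t = _
  ring

/-! ### The global diffeomorphism -/

theorem mul_sq_le_sub_mul_sub {h h' : ℝ → ℝ} {m : ℝ} (hd : ∀ x, HasDerivAt h (h' x) x)
    (hm : ∀ x, m ≤ h' x) (x y : ℝ) : m * (x - y) ^ 2 ≤ (h x - h y) * (x - y) := by
  have hmono : Monotone fun x => h x - m * x := by
    have hd' : ∀ x, HasDerivAt (fun x => h x - m * x) (h' x - m) x := fun x =>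
      ((hd x).sub ((hasDerivAt_id x).const_mul m)).congr_deriv (by simp)
    refine monotone_of_deriv_nonneg (fun x => (hd' x).differentiableAt) fun x => ?_
    rw [(hd' x).deriv]
    linarith [hm x]
  rcases le_total x y with hxy | hxy
  · have := hmono hxy
    simp only at this
    nlinarith
  · have := hmono hxy
    simp only at this
    nlinarith

theorem dirichletOperator_eq {f : ℝ → ℝ → ℝ}
    (hf : ContinuousOn (Function.uncurry f) (Icc (0 : ℝ) 1 ×ˢ univ)) :
    dirichletOperator f hf = semilinearOperator (superposition f hf) := by
  funext x
  refine congrArg (x.secondDeriv - ·) (Lp.ext ?_)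
  filter_upwards [(memLp_comp hf x).coeFn_toLp, coeFn_toL2 (superposition f hf x.toContinuousMap),
    ae_restrict_mem measurableSet_Ioo] with t h1 h2 h3
  rw [h1]
  refine Eq.trans ?_ h2.symm
  have ht := Ioo_subset_Icc_self h3
  rw [show extend (superposition f hf x.toContinuousMap) t = f t (x.toFun ⟨t, ht⟩) from
    extend_coe _ ⟨t, ht⟩, show extend x.toFun t = x.toFun ⟨t, ht⟩ from extend_coe _ ⟨t, ht⟩]

theorem isDiffeomorphism_dirichletOperator {f fx : ℝ → ℝ → ℝ}
    (hf : ContinuousOn (Function.uncurry f) (Icc (0 : ℝ) 1 ×ˢ univ))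
    (hderiv : ∀ t ∈ Icc (0 : ℝ) 1, ∀ x : ℝ, HasDerivAt (f t) (fx t x) x)
    (hfx : ContinuousOn (Function.uncurry fx) (Icc (0 : ℝ) 1 ×ˢ univ)) {m : ℝ}
    (hm : -(Real.pi ^ 2) < m) (hfm : ∀ t ∈ Icc (0 : ℝ) 1, ∀ x, m ≤ fx t x) :
    IsDiffeomorphism (dirichletOperator f hf) := by
  rw [dirichletOperator_eq]
  have hF : ∀ (a b : C(I, ℝ)) t, m * (a t - b t) ^ 2 ≤
      (superposition f hf a t - superposition f hf b t) * (a t - b t) := fun a b t =>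
    mul_sq_le_sub_mul_sub (hderiv t t.2) (hfm t t.2) _ _
  -- The bound `m ≤ fx` is uniform, so the linearization is invertible at every `x`.
  let e : DirichletSpace → DirichletSpace ≃L[ℝ] L2 := fun x =>
    ContinuousLinearEquiv.ofBijective (linearOperator (superposition fx hfx (toContinuousMapCLM x)))
      (LinearMap.ker_eq_bot.2 (linearOperator_bijective hm fun t => hfm t t.2 _).1)
      (LinearMap.range_eq_top.2 (linearOperator_bijective hm fun t => hfm t t.2 _).2)
  have he : ∀ x, (e x : DirichletSpace →L[ℝ] L2) =
      linearOperator (superposition fx hfx (toContinuousMapCLM x)) := fun x => rfl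
  have hfd : ∀ x, HasFDerivAt (semilinearOperator (superposition f hf))
      (e x : DirichletSpace →L[ℝ] L2) x := fun x =>
    (secondDerivLIE : DirichletSpace ≃L[ℝ] L2).hasFDerivAt.sub
      (toL2.hasFDerivAt.comp x ((hasFDerivAt_superposition hf hderiv hfx _).comp x
        toContinuousMapCLM.hasFDerivAt))
  have hcont : Continuous fun x => (e x : DirichletSpace →L[ℝ] L2) := by
    simp only [he, linearOperator]
    refine continuous_const.sub (continuous_const.clm_comp (Continuous.clm_comp
      ((ContinuousLinearMap.mul ℝ C(I, ℝ)).continuous.comp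
        ((continuous_superposition hfx).comp toContinuousMapCLM.continuous)) continuous_const))
  have hC1 : ContDiff ℝ 1 (semilinearOperator (superposition f hf)) :=
    contDiff_one_iff_hasFDerivAt.2 ⟨_, hcont, hfd⟩
  have hopen : IsOpenMap (semilinearOperator (superposition f hf)) :=
    isOpenMap_of_hasStrictFDerivAt_equiv (f' := e) fun x =>
      hC1.contDiffAt.hasStrictFDerivAt' (hfd x) (by simp)
  have hsurj : Function.Surjective (semilinearOperator (superposition f hf)) :=
    -- Closed by the estimate, open by the inverse function theorem; `L²` is connected.
    range_eq_univ.1 (IsClopen.eq_univ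
      ⟨isClosed_range_semilinearOperator hm hF (continuous_superposition hf),
        hopen.isOpen_range⟩ (range_nonempty _))
  let E := Equiv.ofBijective _ ⟨semilinearOperator_injective hm hF, hsurj⟩
  refine ⟨hC1, E, rfl, ?_⟩
  exact (E.toHomeomorphOfContinuousOpen hC1.continuous hopen).contDiff_symm hfd hC1

end DirichletBVP

theorem mainTheorem2 (f fx : ℝ → ℝ → ℝ)
    (hf : ContinuousOn (Function.uncurry f) (Set.Icc (0 : ℝ) 1 ×ˢ Set.univ))
    (hderiv : ∀ t ∈ Set.Icc (0 : ℝ) 1, ∀ x : ℝ, HasDerivAt (f t) (fx t x) x)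
    (hfx : ContinuousOn (Function.uncurry fx) (Set.Icc (0 : ℝ) 1 ×ˢ Set.univ))
    (hgrowth : ∃ A B : ℝ, 0 < A ∧ 0 < B ∧ A < Real.pi ^ 2 ∧
      ∀ t ∈ Set.Icc (0 : ℝ) 1, ∀ x : ℝ, |f t x| ≤ A * |x| + B)
    (hinf : ∃ m : ℝ, IsGLB (Function.uncurry fx '' (Set.Icc (0 : ℝ) 1 ×ˢ Set.univ)) m ∧
      -(Real.pi ^ 2) < m) :
    DirichletBVP.IsDiffeomorphism (DirichletBVP.dirichletOperator f hf) := by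
  obtain ⟨m, hglb, hm⟩ := hinf
  exact DirichletBVP.isDiffeomorphism_dirichletOperator hf hderiv hfx hm fun t ht x =>
    hglb.1 ⟨(t, x), ⟨ht, Set.mem_univ x⟩, rfl⟩
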